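/- Let $\mathbb{K}=\mathbb{R}$ or $\mathbb{C}$, let $1\le p<\infty$, and let $E,F$ be Banach spaces over $\mathbb{K}$. For a Banach space $G$ over $\mathbb{K}$ with topological dual $G^*$, a sequence $(x_j)_{j=1}^\infty$ in $G$ is called - absolutely $p$-summable if $\sum_j\|x_j\|^p<\infty$, i.e. $(x_j)_j\in\ell_p(G)$; - weakly $p$-summable if $(x^*(x_j))_{j}\in\ell_p$ for every $x^*\in G^*$; - mid $p$-summable if it is weakly $p$-summable and $\big((x_n^*(x_j))_{j=1}^\infty\big)_{n=1}^\infty\in\ell_p(\ell_p)$ for every weakly $p$-summable sequence $(x_n^*)_{n=1}^\infty$ in $G^*$. A continuous linear operator between Banach spaces is absolutely $p$-summing (class $\Pi_p$) if it sends weakly $p$-summable sequences to absolutely $p$-summable ones, absolutely mid $p$-summing (class $\Pi_p^{mid}$) if it sends mid $p$-summable sequences to absolutely $p$-summable ones, and weakly mid $p$-summing (class $W_p^{mid}$) if it sends weakly $p$-summable sequences to mid $p$-summable ones. Then $\Pi_p=\Pi_p^{mid}\circ W_p^{mid}$; that is, a continuous linear operator $T\colon E\to F$ is absolutely $p$-summing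 if and only if there are a Banach space $X$ over $\mathbb{K}$, a weakly mid $p$-summing operator $w\colon E\to X$ and an absolutely mid $p$-summing operator $v\colon X\to F$ such that $T=v\circ w$. -/

import Mathlib

universe u v

open scoped ENNReal

/-- `(x_j)` is weakly `p`-summable: `(φ (x_j))_j ∈ ℓ_p` for every `φ` in the topological dual
of `E`.  Absolute `p`-summability of `(x_j)` is Mathlib's `Memℓp x p`. -/
def WeaklySummableSeq (𝕜 : Type*) [RCLike 𝕜] (p : ℝ≥0∞) {E : Type*}
    [NormedAddCommGroup E] [NormedSpace 𝕜 E] (x : ℕ → E) : Prop :=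
  ∀ φ : StrongDual 𝕜 E, Memℓp (fun j => φ (x j)) p

/-- `(x_j)` is mid `p`-summable: it is weakly `p`-summable, and for every weakly `p`-summable
sequence `(φ_n)` in the dual of `E` the double sequence `((φ_n (x_j))_j)_n` belongs to
`ℓ_p(ℓ_p)`: each row is an element `y n` of the Banach space `ℓ_p`, and the sequence of rows is
absolutely `p`-summable in that space. -/
def MidSummableSeq (𝕜 : Type*) [RCLike 𝕜] (p : ℝ≥0∞) [Fact (1 ≤ p)] {E : Type*}
    [NormedAddCommGroup E] [NormedSpace 𝕜 E] (x : ℕ → E) : Prop :=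
  WeaklySummableSeq 𝕜 p x ∧
    ∀ φ : ℕ → StrongDual 𝕜 E, WeaklySummableSeq 𝕜 p φ →
      ∃ y : ℕ → lp (fun _ : ℕ => 𝕜) p, (∀ n j, y n j = φ n (x j)) ∧ Memℓp y p

/-- `Π_p(E;F)`: operators sending weakly `p`-summable sequences to absolutely `p`-summable
sequences. -/
def absolutelySumming (𝕜 : Type*) [RCLike 𝕜] (p : ℝ≥0∞) (E F : Type*)
    [NormedAddCommGroup E] [NormedSpace 𝕜 E] [NormedAddCommGroup F] [NormedSpace 𝕜 F] :
    Set (E →L[𝕜] F) :=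
  {T | ∀ x : ℕ → E, WeaklySummableSeq 𝕜 p x → Memℓp (fun j => T (x j)) p}

/-- `Π_p^mid(E;F)`: operators sending mid `p`-summable sequences to absolutely `p`-summable
sequences. -/
def absolutelyMidSumming (𝕜 : Type*) [RCLike 𝕜] (p : ℝ≥0∞) [Fact (1 ≤ p)] (E F : Type*)
    [NormedAddCommGroup E] [NormedSpace 𝕜 E] [NormedAddCommGroup F] [NormedSpace 𝕜 F] :
    Set (E →L[𝕜] F) :=
  {T | ∀ x : ℕ → E, MidSummableSeq 𝕜 p x → Memℓp (fun j => T (x j)) p}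

/-- `W_p^mid(E;F)`: operators sending weakly `p`-summable sequences to mid `p`-summable
sequences. -/
def weaklyMidSumming (𝕜 : Type*) [RCLike 𝕜] (p : ℝ≥0∞) [Fact (1 ≤ p)] (E F : Type*)
    [NormedAddCommGroup E] [NormedSpace 𝕜 E] [NormedAddCommGroup F] [NormedSpace 𝕜 F] :
    Set (E →L[𝕜] F) :=
  {T | ∀ x : ℕ → E, WeaklySummableSeq 𝕜 p x → MidSummableSeq 𝕜 p (fun j => T (x j))}

universe w

/-! The composite of the two kinds of operators is visibly absolutely `p`-summing; the content is
the factorization. By Pietsch domination (`exists_pietsch_measure`) an absolutely summing `T`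
satisfies `‖T x‖ ^ p ≤ C * ∫ |φ x| ^ p dμ(φ)` for a probability measure `μ` on the weak-* compact
dual ball. Let `X` be the completion of `E` for the `L_p(μ)` seminorm: `T` extends continuously to
`X`, and `X` is isometric to a subspace of `L_p(μ)`.

The canonical map `E → X` sends weakly summable sequences to absolutely summable ones, which are mid
summable (`midSummableSeq_of_memℓp`). Conversely, in a subspace of `L_p(μ)` mid summable sequences
are absolutely summable (`MidSummableSeq.memℓp_of_linearIsometry`), so every bounded operator out of
`X` is absolutely mid summing.

This last fact holds because mid summability of `x` makes `φ ↦ (φ (x j))_j` an absolutely summing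
operator from the dual to `ℓ_p`. It is therefore bounded uniformly over finite families of
functionals defining contractions into `ℓ_p`, and averaging over a finite partition gives such
contractions that almost preserve the norms of finitely many vectors of `L_p(μ)`. -/

theorem ENNReal.one_le_toReal_of_fact {p : ℝ≥0∞} [hp1 : Fact (1 ≤ p)] (hp : p ≠ ∞) :
    1 ≤ p.toReal := by
  simpa using ENNReal.toReal_mono hp hp1.out

/-! ### Uniform constants for summing operators and for weakly and mid summable sequences. -/

section SummingBounds

variable {𝕜 : Type*} [RCLike 𝕜] {p : ℝ≥0∞} [Fact (1 ≤ p)]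
  {E F : Type*} [NormedAddCommGroup E] [NormedSpace 𝕜 E] [NormedAddCommGroup F] [NormedSpace 𝕜 F]

theorem memℓp_iff_summable_norm_rpow {ι : Type*} (hp : p ≠ ∞) (x : ι → E) :
    Memℓp x p ↔ Summable fun i => ‖x i‖ ^ p.toReal :=
  memℓp_gen_iff (zero_lt_one.trans_le (ENNReal.one_le_toReal_of_fact hp))

/-- A bound for the functionals in the unit ball rescales to all functionals. -/
theorem sum_norm_rpow_le_of_unit_ball {ι : Type*} {r : ℝ} (hr : 1 ≤ r) (s : Finset ι) (x : ι → E)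
    {M : ℝ} (hM : ∀ φ : StrongDual 𝕜 E, ‖φ‖ ≤ 1 → ∑ i ∈ s, ‖φ (x i)‖ ^ r ≤ M)
    (φ : StrongDual 𝕜 E) : ∑ i ∈ s, ‖φ (x i)‖ ^ r ≤ ‖φ‖ ^ r * M := by
  have hr0 : r ≠ 0 := by positivity
  rcases eq_or_ne φ 0 with rfl | hφ
  · simp [Real.zero_rpow hr0]
  have hn : 0 < ‖φ‖ := norm_pos_iff.2 hφ
  have h := hM ((‖φ‖⁻¹ : ℝ) • φ) (by simp [norm_smul, hn.ne'])
  have h2 : ∀ i, ‖((‖φ‖⁻¹ : ℝ) • φ) (x i)‖ ^ r = (‖φ‖ ^ r)⁻¹ * ‖φ (x i)‖ ^ r := fun i => by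
    change ‖(‖φ‖⁻¹ : ℝ) • φ (x i)‖ ^ r = _
    rw [norm_smul, Real.mul_rpow (norm_nonneg _) (norm_nonneg _), norm_inv, norm_norm,
      Real.inv_rpow hn.le]
  simp only [h2, ← Finset.mul_sum] at h
  have hn' : 0 < ‖φ‖ ^ r := by positivity
  rwa [inv_mul_le_iff₀ hn'] at h

/-- Serves to glue finite blocks, block `k` scaled by `c k`, into one sequence indexed by `ℕ`
through `e` and zero off its range. It is applied both to functionals and to the operator under
study. -/
theorem summable_norm_rpow_extend_iff {r : ℝ} (hr0 : r ≠ 0) {n : ℕ → ℕ} {c : ℕ → ℝ}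
    (hc0 : ∀ k, 0 ≤ c k) (x : ∀ k, Fin (n k) → E) {e : (Σ k, Fin (n k)) → ℕ}
    (he : Function.Injective e) (A : E →ₗ[𝕜] F) :
    (Summable fun j => ‖A (Function.extend e (fun a => (c a.1 : 𝕜) • x a.1 a.2) 0 j)‖ ^ r) ↔
      Summable fun k => c k ^ r * ∑ i, ‖A (x k i)‖ ^ r := by
  have h1 : ∀ a : Σ k, Fin (n k),
      ‖A ((c a.1 : 𝕜) • x a.1 a.2)‖ ^ r = c a.1 ^ r * ‖A (x a.1 a.2)‖ ^ r := fun a => by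
    rw [map_smul, norm_smul, Real.mul_rpow (norm_nonneg _) (norm_nonneg _), RCLike.norm_ofReal,
      abs_of_nonneg (hc0 _)]
  rw [← he.summable_iff fun j hj => by
    rw [Function.extend_apply' _ _ _ (fun ⟨a, ha⟩ => hj ⟨a, ha⟩)]
    simp [Real.zero_rpow hr0]]
  simp only [Function.comp_def, he.extend_apply, h1]
  rw [summable_sigma_of_nonneg fun a => mul_nonneg (Real.rpow_nonneg (hc0 _) _) (by positivity)]
  simp only [tsum_fintype, Finset.mul_sum]
  exact and_iff_right fun k => (hasSum_fintype _).summable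

/-- A linear map sending weakly `p`-summable sequences to absolutely `p`-summable ones satisfies a
uniform inequality on finite families. -/
theorem exists_summing_constant (hp : p ≠ ∞) (R : E →ₗ[𝕜] F)
    (hR : ∀ x : ℕ → E, WeaklySummableSeq 𝕜 p x → Memℓp (fun j => R (x j)) p) :
    ∃ C : ℝ, 0 ≤ C ∧ ∀ (n : ℕ) (x : Fin n → E) (M : ℝ),
      (∀ φ : StrongDual 𝕜 E, ‖φ‖ ≤ 1 → ∑ i, ‖φ (x i)‖ ^ p.toReal ≤ M) →
        ∑ i, ‖R (x i)‖ ^ p.toReal ≤ C * M := by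
  have hr := ENNReal.one_le_toReal_of_fact hp
  simp only [WeaklySummableSeq, memℓp_iff_summable_norm_rpow hp] at hR
  set r := p.toReal
  have hr0 : r ≠ 0 := by positivity
  by_contra! h
  -- Block `k` violates the inequality with constant `4 ^ k`. Scaling by `S k ^ (-1 / r)` makes its
  -- strong sum equal to `1` and its weak sums at most `‖φ‖ ^ r / 4 ^ k`, so the glued sequence is
  -- weakly but not absolutely summable.
  have h' := fun k : ℕ => h (4 ^ k) (by positivity)
  choose n x M hM hlt using h'
  have hM0 : ∀ k, 0 ≤ M k := fun k => by simpa [Real.zero_rpow hr0] using hM k 0 (by simp)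
  set S : ℕ → ℝ := fun k => ∑ i, ‖R (x k i)‖ ^ r
  have hSpos : ∀ k, 0 < S k := fun k =>
    lt_of_le_of_lt (mul_nonneg (by positivity) (hM0 k)) (hlt k)
  set c : ℕ → ℝ := fun k => ((S k)⁻¹) ^ r⁻¹
  have hc0 : ∀ k, 0 ≤ c k := fun k => Real.rpow_nonneg (inv_nonneg.2 (hSpos k).le) _
  have hcr : ∀ k, c k ^ r = (S k)⁻¹ := fun k =>
    Real.rpow_inv_rpow (inv_nonneg.2 (hSpos k).le) hr0
  obtain ⟨e, he⟩ := exists_injective_nat (Σ k, Fin (n k))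
  have hsum := hR (Function.extend e (fun a => (c a.1 : 𝕜) • x a.1 a.2) 0) fun φ => by
    refine (summable_norm_rpow_extend_iff hr0 hc0 x he (φ : E →ₗ[𝕜] 𝕜)).2 ?_
    simp only [hcr, ContinuousLinearMap.coe_coe]
    refine Summable.of_nonneg_of_le (fun k => ?_) (fun k => ?_)
      ((summable_geometric_of_lt_one (r := (1 / 4 : ℝ)) (by norm_num) (by norm_num)).mul_left
        (‖φ‖ ^ r))
    · exact mul_nonneg (inv_nonneg.2 (hSpos k).le) (by positivity)
    · have h2 := sum_norm_rpow_le_of_unit_ball hr Finset.univ (x k) (hM k) φ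
      calc (S k)⁻¹ * ∑ i, ‖φ (x k i)‖ ^ r ≤ (S k)⁻¹ * (‖φ‖ ^ r * M k) :=
            mul_le_mul_of_nonneg_left h2 (inv_nonneg.2 (hSpos k).le)
        _ = ‖φ‖ ^ r * ((S k)⁻¹ * M k) := by ring
        _ ≤ ‖φ‖ ^ r * (1 / 4) ^ k := by
            refine mul_le_mul_of_nonneg_left ?_ (by positivity)
            rw [inv_mul_le_iff₀ (hSpos k), one_div, inv_pow, ← div_eq_mul_inv,
              le_div_iff₀ (by positivity), mul_comm]
            exact (hlt k).le
  have h1 := (summable_norm_rpow_extend_iff hr0 hc0 x he R).1 hsum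
  simp only [hcr] at h1
  have h2 : (fun k => (S k)⁻¹ * ∑ i, ‖R (x k i)‖ ^ r) = fun _ => (1 : ℝ) :=
    funext fun k => inv_mul_cancel₀ (hSpos k).ne'
  rw [h2] at h1
  exact one_ne_zero ((summable_const_iff (1 : ℝ)).1 h1)

/-- A weakly `p`-summable sequence induces a bounded operator from the dual to `ℓ_p`. -/
theorem WeaklySummableSeq.exists_continuousLinearMap {x : ℕ → E} (hx : WeaklySummableSeq 𝕜 p x) :
    ∃ R : StrongDual 𝕜 E →L[𝕜] lp (fun _ : ℕ => 𝕜) p, ∀ φ j, R φ j = φ (x j) := by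
  let R : StrongDual 𝕜 E →ₗ[𝕜] lp (fun _ : ℕ => 𝕜) p :=
    { toFun := fun φ => ⟨fun j => φ (x j), hx φ⟩
      map_add' := fun φ ψ => rfl
      map_smul' := fun c φ => rfl }
  -- The graph is closed because convergence on either side implies convergence of each coordinate.
  refine ⟨ContinuousLinearMap.ofSeqClosedGraph (g := R) fun u φ y hu hRu => ?_, fun φ j => rfl⟩
  have hcoe := (lp.uniformContinuous_coe (E := fun _ : ℕ => 𝕜) (p := p)).continuous
  ext j
  have h1 := (((continuous_apply j).comp hcoe).tendsto y).comp hRu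
  have h2 : Filter.Tendsto (fun n => u n (x j)) Filter.atTop (nhds (φ (x j))) :=
    ((ContinuousLinearMap.apply 𝕜 𝕜 (x j)).continuous.tendsto φ).comp hu
  exact tendsto_nhds_unique h1 h2

theorem WeaklySummableSeq.exists_sum_bound (hp : p ≠ ∞) {x : ℕ → E}
    (hx : WeaklySummableSeq 𝕜 p x) :
    ∃ C : ℝ, 0 ≤ C ∧ ∀ (φ : StrongDual 𝕜 E) (s : Finset ℕ),
      ∑ j ∈ s, ‖φ (x j)‖ ^ p.toReal ≤ C * ‖φ‖ ^ p.toReal := by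
  obtain ⟨R, hR⟩ := hx.exists_continuousLinearMap
  have hr := ENNReal.one_le_toReal_of_fact hp
  refine ⟨‖R‖ ^ p.toReal, by positivity, fun φ s => ?_⟩
  have h1 := sum_le_hasSum s (fun j _ => by positivity)
    (lp.hasSum_norm (zero_lt_one.trans_le hr) (R φ))
  simp only [hR] at h1
  refine h1.trans ?_
  rw [← Real.mul_rpow (norm_nonneg R) (norm_nonneg φ)]
  exact Real.rpow_le_rpow (norm_nonneg _) (R.le_opNorm φ) (by positivity)

theorem weaklySummableSeq_of_memℓp (hp : p ≠ ∞) {x : ℕ → E} (hx : Memℓp x p) :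
    WeaklySummableSeq 𝕜 p x := by
  intro φ
  have hr := ENNReal.one_le_toReal_of_fact hp
  rw [memℓp_iff_summable_norm_rpow hp] at hx ⊢
  refine Summable.of_nonneg_of_le (fun j => by positivity) (fun j => ?_)
    (hx.mul_left (‖φ‖ ^ p.toReal))
  rw [← Real.mul_rpow (norm_nonneg _) (norm_nonneg _)]
  exact Real.rpow_le_rpow (norm_nonneg _) (φ.le_opNorm _) (by positivity)

/-- Absolutely `p`-summable sequences are mid `p`-summable. -/
theorem midSummableSeq_of_memℓp (hp : p ≠ ∞) {x : ℕ → E} (hx : Memℓp x p) :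
    MidSummableSeq 𝕜 p x := by
  have hr := ENNReal.one_le_toReal_of_fact hp
  have hr' : 0 < p.toReal := zero_lt_one.trans_le hr
  have hw := weaklySummableSeq_of_memℓp (𝕜 := 𝕜) hp hx
  refine ⟨hw, fun φ hφ => ⟨fun n => ⟨fun j => φ n (x j), hw (φ n)⟩, fun n j => rfl, ?_⟩⟩
  obtain ⟨C, hC0, hC⟩ := hφ.exists_sum_bound hp
  rw [memℓp_iff_summable_norm_rpow hp] at hx ⊢
  refine summable_of_sum_le (c := ∑' j, C * ‖x j‖ ^ p.toReal) (fun n => by positivity)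
    fun s => ?_
  -- Exchange the two sums: for fixed `j`, the weak bound for `φ` is tested on evaluation at `x j`,
  -- an element of the bidual of norm at most `‖x j‖`.
  refine hasSum_le (fun j => ?_) (hasSum_sum fun n _ => lp.hasSum_norm hr'
    (⟨fun j => φ n (x j), hw (φ n)⟩ : lp (fun _ : ℕ => 𝕜) p)) (hx.mul_left C).hasSum
  refine (hC (NormedSpace.inclusionInDoubleDual 𝕜 E (x j)) s).trans ?_
  gcongr
  exact NormedSpace.double_dual_bound 𝕜 E (x j)

/-- Testing `p`-sums of functionals on vectors of the unit ball controls the weak `p`-sums. -/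
theorem sum_norm_rpow_bidual_le {ι : Type*} [Fintype ι] {r : ℝ} (hr : 1 ≤ r)
    (φ : ι → StrongDual 𝕜 E) {M : ℝ} (hM : ∀ f : E, ‖f‖ ≤ 1 → ∑ i, ‖φ i f‖ ^ r ≤ M)
    (ψ : StrongDual 𝕜 (StrongDual 𝕜 E)) (hψ : ‖ψ‖ ≤ 1) : ∑ i, ‖ψ (φ i)‖ ^ r ≤ M := by
  have hr0 : 0 < r := zero_lt_one.trans_le hr
  set S := ∑ i, ‖ψ (φ i)‖ ^ r with hS
  have hS0 : 0 ≤ S := by positivity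
  have hM0 : 0 ≤ M := by simpa [Real.zero_rpow hr0.ne'] using hM 0 (by simp)
  -- Young's inequality in a form that includes `r = 1`.
  have young : ∀ a t : ℝ, 0 ≤ a → 0 ≤ t → a ^ (r - 1) * t ≤ ((r - 1) * a ^ r + t ^ r) / r := by
    intro a t ha ht
    have h := Real.geom_mean_le_arith_mean2_weighted (w₁ := (r - 1) / r) (w₂ := 1 / r)
      (p₁ := a ^ r) (p₂ := t ^ r) (div_nonneg (by linarith) hr0.le) (by positivity)
      (by positivity) (by positivity) (by field_simp; ring)
    rw [← Real.rpow_mul ha, ← Real.rpow_mul ht, mul_div_cancel₀ _ hr0.ne',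
      mul_one_div_cancel hr0.ne', Real.rpow_one] at h
    refine h.trans_eq ?_
    field_simp
  -- Coefficients with `b i * ψ (φ i) = |ψ (φ i)| ^ r`; division by zero gives `b i = 0` when `ψ (φ
  -- i) = 0`. Then `S = ψ (∑ b i • φ i)`, and Young's inequality on the unit ball yields `r * S ≤ (r
  -- - 1) * S + M`, that is, `S ≤ M`.
  let b : ι → 𝕜 := fun i =>
    ((‖ψ (φ i)‖ ^ (r - 1) : ℝ) : 𝕜) * ((starRingEnd 𝕜) (ψ (φ i)) / (‖ψ (φ i)‖ : 𝕜))
  have hb1 : ∀ i, ‖b i‖ ≤ ‖ψ (φ i)‖ ^ (r - 1) := fun i => by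
    simp only [b, norm_mul, norm_div, RCLike.norm_conj, RCLike.norm_ofReal, abs_norm]
    rw [abs_of_nonneg (by positivity)]
    exact mul_le_of_le_one_right (by positivity) (div_self_le_one _)
  have hb2 : ∀ i, b i * ψ (φ i) = ((‖ψ (φ i)‖ ^ r : ℝ) : 𝕜) := fun i => by
    rcases eq_or_ne (ψ (φ i)) 0 with h0 | h0
    · simp [h0, Real.zero_rpow hr0.ne']
    · have hn : 0 < ‖ψ (φ i)‖ := norm_pos_iff.2 h0
      have hn' : (‖ψ (φ i)‖ : 𝕜) ≠ 0 := by exact_mod_cast hn.ne'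
      have h3 : ‖ψ (φ i)‖ ^ r = ‖ψ (φ i)‖ ^ (r - 1) * ‖ψ (φ i)‖ := by
        rw [← Real.rpow_add_one hn.ne', sub_add_cancel]
      simp only [b]
      rw [mul_assoc, div_mul_eq_mul_div, RCLike.conj_mul, h3, sq, mul_div_cancel_right₀ _ hn']
      exact (RCLike.ofReal_mul _ _).symm
  have h1 : ψ (∑ i, b i • φ i) = (S : 𝕜) := by
    simp only [map_sum, map_smul, smul_eq_mul, hb2, hS]
  have h2 : ‖∑ i, b i • φ i‖ ≤ ((r - 1) * S + M) / r := by
    refine ContinuousLinearMap.opNorm_le_of_unit_norm ?_ fun f hf => ?_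
    · exact div_nonneg (add_nonneg (mul_nonneg (by linarith) hS0) hM0) hr0.le
    · calc ‖(∑ i, b i • φ i) f‖ = ‖∑ i, b i * φ i f‖ := by simp
        _ ≤ ∑ i, ‖b i‖ * ‖φ i f‖ := norm_sum_le_of_le _ fun i _ => (norm_mul _ _).le
        _ ≤ ∑ i, ((r - 1) * ‖ψ (φ i)‖ ^ r + ‖φ i f‖ ^ r) / r := Finset.sum_le_sum fun i _ =>
            (mul_le_mul_of_nonneg_right (hb1 i) (norm_nonneg _)).trans
              (young _ _ (norm_nonneg _) (norm_nonneg _))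
        _ = ((r - 1) * S + ∑ i, ‖φ i f‖ ^ r) / r := by
            rw [← Finset.sum_div, Finset.sum_add_distrib, ← Finset.mul_sum]
        _ ≤ ((r - 1) * S + M) / r := by
            gcongr
            exact hM f hf.le
  have h3 : S ≤ ((r - 1) * S + M) / r := by
    calc S = ‖ψ (∑ i, b i • φ i)‖ := by rw [h1, RCLike.norm_ofReal, abs_of_nonneg hS0]
      _ ≤ 1 * ‖∑ i, b i • φ i‖ := ψ.le_of_opNorm_le hψ _
      _ ≤ _ := by rw [one_mul]; exact h2
  rw [le_div_iff₀ hr0] at h3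
  linarith

/-- A mid `p`-summable sequence is uniformly `p`-summable under finite families of functionals
defining contractions into `ℓ_p`. -/
theorem MidSummableSeq.exists_sum_bound (hp : p ≠ ∞) {x : ℕ → E} (hx : MidSummableSeq 𝕜 p x) :
    ∃ C : ℝ, ∀ (ι : Type w) [Fintype ι] (φ : ι → StrongDual 𝕜 E),
      (∀ f : E, ‖f‖ ≤ 1 → ∑ i, ‖φ i f‖ ^ p.toReal ≤ 1) → ∀ s : Finset ℕ,
        ∑ j ∈ s, ∑ i, ‖φ i (x j)‖ ^ p.toReal ≤ C := by
  have hr := ENNReal.one_le_toReal_of_fact hp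
  obtain ⟨R, hR⟩ := hx.1.exists_continuousLinearMap
  -- The second clause of mid summability says that `R` is absolutely summing.
  obtain ⟨C, -, hC⟩ := exists_summing_constant hp (R : StrongDual 𝕜 E →ₗ[𝕜] _) fun φ hφ => by
    obtain ⟨y, hy, hyp⟩ := hx.2 φ hφ
    convert! hyp with n
    ext j
    rw [hy]
    exact hR _ _
  refine ⟨C, fun ι _ φ hφ s => ?_⟩
  have e := Fintype.equivFin ι
  have h := hC _ (φ ∘ e.symm) 1 (sum_norm_rpow_bidual_le hr _ fun f hf => by
    simpa only [Function.comp_apply, Equiv.sum_comp e.symm fun i => ‖φ i f‖ ^ p.toReal]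
      using hφ f hf)
  simp only [Function.comp_apply, ContinuousLinearMap.coe_coe, mul_one,
    Equiv.sum_comp e.symm fun i => ‖R (φ i)‖ ^ p.toReal] at h
  rw [Finset.sum_comm]
  refine le_trans (Finset.sum_le_sum fun i _ => ?_) h
  have h1 := sum_le_hasSum s (fun j _ => by positivity)
    (lp.hasSum_norm (zero_lt_one.trans_le hr) (R (φ i)))
  simpa only [hR] using h1

end SummingBounds

/-! ### Probability measures from cones of continuous functions. -/

open MeasureTheory

/-- A cone of continuous functions on a compact space, each of which takes a nonnegative value
somewhere, is nonnegative in mean for some probability measure. -/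
theorem exists_isProbabilityMeasure_integral_nonneg {K : Type*} [TopologicalSpace K]
    [CompactSpace K] [T2Space K] [MeasurableSpace K] [BorelSpace K] (Q : PointedCone ℝ C(K, ℝ))
    (hQ : ∀ q ∈ Q, ∃ k, 0 ≤ q k) :
    ∃ μ : Measure K, IsProbabilityMeasure μ ∧ ∀ q ∈ Q, 0 ≤ ∫ k, q k ∂μ := by
  -- Applying the hypothesis to `0 ∈ Q` shows that `K` is nonempty.
  obtain ⟨k₀, -⟩ := hQ 0 Q.zero_mem
  have h1 : (1 : C(K, ℝ)) ≠ 0 := fun h => one_ne_zero (DFunLike.congr_fun h k₀)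
  -- The upward closure of `Q` contains both `Q` and the nonnegative functions. A constant in it is
  -- nonnegative, so `a • 1 ↦ a` has an extension nonnegative on `s`: a positive functional of total
  -- mass one.
  let s : PointedCone ℝ C(K, ℝ) :=
    { carrier := {f | ∃ q ∈ Q, q ≤ f}
      zero_mem' := ⟨0, Q.zero_mem, le_rfl⟩
      add_mem' := by
        rintro f g ⟨q, hq, hqf⟩ ⟨q', hq', hqg⟩
        exact ⟨q + q', Q.add_mem hq hq', add_le_add hqf hqg⟩
      smul_mem' := by
        rintro c f ⟨q, hq, hqf⟩
        exact ⟨c • q, Submodule.smul_mem Q c hq, fun k => mul_le_mul_of_nonneg_left (hqf k) c.2⟩ }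
  obtain ⟨Λ, hΛ1, hΛ⟩ := riesz_extension s (LinearPMap.mkSpanSingleton (K := ℝ) 1 (1 : ℝ) h1)
    (by
      rintro ⟨x, hx⟩ ⟨q, hq, hqx⟩
      obtain ⟨a, rfl⟩ := Submodule.mem_span_singleton.1 hx
      obtain ⟨k, hk⟩ := hQ q hq
      rw [LinearPMap.mkSpanSingleton'_apply]
      have := hk.trans (hqx k)
      simpa using this)
    (fun y => ⟨⟨‖y‖ • 1, Submodule.mem_span_singleton.2 ⟨_, rfl⟩⟩, 0, Q.zero_mem, fun k => by
      have := neg_le_of_abs_le (y.norm_coe_le_norm k)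
      simp
      linarith⟩)
  have hone : Λ 1 = 1 := by
    exact (hΛ1 ⟨1, Submodule.mem_span_singleton_self _⟩).trans
      (LinearPMap.mkSpanSingleton_apply ℝ ℝ h1 1)
  let Λ' : CompactlySupportedContinuousMap K ℝ →ₚ[ℝ] ℝ := PositiveLinearMap.mk₀
    { toFun := fun f => Λ f.toContinuousMap
      map_add' := fun f g => Λ.map_add f.toContinuousMap g.toContinuousMap
      map_smul' := fun c f => Λ.map_smul c f.toContinuousMap }
    fun f hf => hΛ _ ⟨0, Q.zero_mem, hf⟩
  have hint : ∀ f : C(K, ℝ), ∫ k, f k ∂(RealRMK.rieszMeasure Λ') = Λ f := fun f =>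
    RealRMK.integral_rieszMeasure Λ' (CompactlySupportedContinuousMap.continuousMapEquiv f)
  refine ⟨RealRMK.rieszMeasure Λ', ⟨?_⟩, fun q hq => ?_⟩
  · have h := hint 1
    rw [hone] at h
    simp only [ContinuousMap.one_apply, integral_const, smul_eq_mul, mul_one, Measure.real] at h
    exact (ENNReal.toReal_eq_one_iff _).1 h
  · rw [hint]
    exact hΛ q ⟨q, hq, le_rfl⟩

/-! ### Pietsch domination on the dual unit ball. -/

section PietschDomination

variable {𝕜 : Type*} [RCLike 𝕜] {E F : Type*} [NormedAddCommGroup E] [NormedSpace 𝕜 E]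
  [NormedAddCommGroup F] [NormedSpace 𝕜 F]

variable (𝕜 E) in
/-- The closed unit ball of the dual with the weak-* topology. -/
abbrev DualUnitBall : Type _ :=
  ↥(WeakDual.toStrongDual ⁻¹' Metric.closedBall (0 : StrongDual 𝕜 E) 1)

namespace DualUnitBall

instance : CompactSpace (DualUnitBall 𝕜 E) :=
  isCompact_iff_compactSpace.1 (WeakDual.isCompact_closedBall 0 1)

noncomputable instance : MeasurableSpace (DualUnitBall 𝕜 E) := borel _

instance : BorelSpace (DualUnitBall 𝕜 E) := ⟨rfl⟩

theorem norm_le (k : DualUnitBall 𝕜 E) : ‖WeakDual.toStrongDual k.1‖ ≤ 1 :=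
  mem_closedBall_zero_iff.1 k.2

variable (𝕜 E) in
/-- Evaluation of functionals of the dual unit ball. -/
noncomputable def eval : E →ₗ[𝕜] C(DualUnitBall 𝕜 E, 𝕜) where
  toFun x := ⟨fun k => k.1 x, (WeakDual.eval_continuous x).comp continuous_subtype_val⟩
  map_add' x y := by ext k; exact map_add k.1 x y
  map_smul' c x := by ext k; exact map_smul k.1 c x

end DualUnitBall

open DualUnitBall

/-- **Pietsch domination**, from an inequality on finite families. -/
theorem exists_pietsch_measure {r : ℝ} (hr : 1 ≤ r) (R : E →ₗ[𝕜] F) {C : ℝ}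
    (hC : ∀ (n : ℕ) (x : Fin n → E) (M : ℝ),
      (∀ φ : StrongDual 𝕜 E, ‖φ‖ ≤ 1 → ∑ i, ‖φ (x i)‖ ^ r ≤ M) →
        ∑ i, ‖R (x i)‖ ^ r ≤ C * M) :
    ∃ μ : Measure (DualUnitBall 𝕜 E), IsProbabilityMeasure μ ∧
      ∀ x, ‖R x‖ ^ r ≤ C * ∫ k, ‖eval 𝕜 E x k‖ ^ r ∂μ := by
  have hr0 : 0 < r := zero_lt_one.trans_le hr
  have hcont : ∀ x, Continuous fun k => ‖eval 𝕜 E x k‖ ^ r := fun x =>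
    (eval 𝕜 E x).continuous.norm.rpow_const fun _ => Or.inr hr0.le
  let h : E → C(DualUnitBall 𝕜 E, ℝ) := fun x =>
    ⟨fun k => C * ‖eval 𝕜 E x k‖ ^ r - ‖R x‖ ^ r, ((hcont x).const_mul C).sub continuous_const⟩
  let Q : PointedCone ℝ C(DualUnitBall 𝕜 E, ℝ) :=
    { carrier := {f | ∃ (n : ℕ) (x : Fin n → E), f = ∑ i, h (x i)}
      zero_mem' := ⟨0, Fin.elim0, by simp⟩
      add_mem' := by
        rintro f g ⟨n, x, rfl⟩ ⟨m, y, rfl⟩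
        exact ⟨n + m, Fin.append x y, by simp [Fin.sum_univ_add]⟩
      smul_mem' := by
        rintro ⟨c, hc⟩ f ⟨n, x, rfl⟩
        -- `h` is homogeneous of degree `r`, so the factor `c` is absorbed by scaling the vectors by
        -- `c ^ (1 / r)`.
        refine ⟨n, fun i => ((c ^ r⁻¹ : ℝ) : 𝕜) • x i, ?_⟩
        rw [Finset.smul_sum]
        refine Finset.sum_congr rfl fun i _ => ?_
        ext k
        have h2 : ∀ a : ℝ, 0 ≤ a → (‖((c ^ r⁻¹ : ℝ) : 𝕜)‖ * a) ^ r = c * a ^ r := fun a ha => by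
          rw [RCLike.norm_ofReal, abs_of_nonneg (Real.rpow_nonneg hc _),
            Real.mul_rpow (Real.rpow_nonneg hc _) ha, Real.rpow_inv_rpow hc hr0.ne']
        change c * (C * ‖eval 𝕜 E (x i) k‖ ^ r - ‖R (x i)‖ ^ r) =
          C * ‖eval 𝕜 E (((c ^ r⁻¹ : ℝ) : 𝕜) • x i) k‖ ^ r - ‖R (((c ^ r⁻¹ : ℝ) : 𝕜) • x i)‖ ^ r
        rw [map_smul, map_smul, ContinuousMap.smul_apply, norm_smul, norm_smul,
          h2 _ (norm_nonneg _), h2 _ (norm_nonneg _)]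
        ring }
  obtain ⟨μ, hμ, hμQ⟩ := exists_isProbabilityMeasure_integral_nonneg Q (by
    rintro q ⟨n, x, rfl⟩
    have : Nonempty (DualUnitBall 𝕜 E) := ⟨⟨0, by simp⟩⟩
    -- The maximum over the dual ball is an admissible `M` in `hC`, which makes `∑ h (x i)`
    -- nonnegative where it is attained.
    obtain ⟨k, -, hk⟩ := isCompact_univ.exists_isMaxOn Set.univ_nonempty
      (continuous_finsetSum Finset.univ fun i _ => hcont (x i)).continuousOn
    refine ⟨k, ?_⟩
    have h3 := hC n x _ fun φ hφ => hk (Set.mem_univ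
      (⟨StrongDual.toWeakDual φ, by simpa using hφ⟩ : DualUnitBall 𝕜 E))
    simp only [h, ContinuousMap.coe_sum, Finset.sum_apply, ContinuousMap.coe_mk,
      Finset.sum_sub_distrib, ← Finset.mul_sum]
    exact sub_nonneg.2 h3)
  refine ⟨μ, hμ, fun x => ?_⟩
  have h4 := hμQ (h x) ⟨1, fun _ => x, by simp⟩
  have hi : Integrable (fun k => ‖eval 𝕜 E x k‖ ^ r) μ :=
    (hcont x).integrable_of_hasCompactSupport (HasCompactSupport.of_compactSpace _)
  have h5 : ∫ k, h x k ∂μ = C * ∫ k, ‖eval 𝕜 E x k‖ ^ r ∂μ - ‖R x‖ ^ r := by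
    simp only [h, ContinuousMap.coe_mk]
    rw [integral_sub (hi.const_mul C) (integrable_const _), integral_const_mul]
    simp
  rw [h5] at h4
  linarith

end PietschDomination

/-! ### Averaging operators on `L_p` and mid summability in its subspaces. -/

section LpAverages

variable {𝕜 : Type w} [RCLike 𝕜] {p : ℝ≥0∞} [Fact (1 ≤ p)] {α : Type*} [MeasurableSpace α]
  {μ : Measure α}

theorem toReal_eLpNorm_rpow_eq_integral (hp : p ≠ ∞) {G : Type*} [NormedAddCommGroup G] {f : α → G}
    (hf : MemLp f p μ) :
    (eLpNorm f p μ).toReal ^ p.toReal = ∫ a, ‖f a‖ ^ p.toReal ∂μ := by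
  have hr := ENNReal.one_le_toReal_of_fact hp
  have hp0 : p ≠ 0 := (zero_lt_one.trans_le (Fact.out : 1 ≤ p)).ne'
  have h0 : 0 ≤ ∫ a, ‖f a‖ ^ p.toReal ∂μ := integral_nonneg fun a => by positivity
  rw [hf.eLpNorm_eq_integral_rpow_norm hp0 hp,
    ENNReal.toReal_ofReal (Real.rpow_nonneg h0 _), Real.rpow_inv_rpow h0 (by positivity)]

theorem Lp.norm_rpow_eq_integral (hp : p ≠ ∞) (f : Lp 𝕜 p μ) :
    ‖f‖ ^ p.toReal = ∫ a, ‖f a‖ ^ p.toReal ∂μ := by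
  rw [Lp.norm_def, toReal_eLpNorm_rpow_eq_integral hp (Lp.memLp f)]

theorem PiLp.norm_rpow_eq_sum (hp : p ≠ ∞) {ι : Type*} [Fintype ι] (x : PiLp p fun _ : ι => 𝕜) :
    ‖x‖ ^ p.toReal = ∑ i, ‖x i‖ ^ p.toReal := by
  have hr := ENNReal.one_le_toReal_of_fact hp
  rw [PiLp.norm_eq_sum (zero_lt_one.trans_le hr), ← Real.rpow_mul (by positivity),
    one_div_mul_cancel (by positivity), Real.rpow_one]

variable [IsFiniteMeasure μ]

theorem integrable_of_Lp (f : Lp 𝕜 p μ) : Integrable f μ :=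
  (Lp.memLp f).integrable Fact.out

/-- The normalized averages of an `L_p` function over a finite family of sets. -/
noncomputable def lpAverage (p : ℝ≥0∞) [Fact (1 ≤ p)] (μ : Measure α) [IsFiniteMeasure μ]
    {ι : Type*} (A : ι → Set α) : Lp 𝕜 p μ →ₗ[𝕜] PiLp p (fun _ : ι => 𝕜) where
  -- The exponent `1 / p - 1` sends a function equal to `c` on `A i` to `μ(A i) ^ (1 / p) * c`,
  -- whose modulus is its `L_p` norm there. On a null cell the integral vanishes, so the value of
  -- the factor is irrelevant.
  toFun f := WithLp.toLp p fun i =>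
    ((μ.real (A i) ^ (p.toReal⁻¹ - 1) : ℝ) : 𝕜) * ∫ a in A i, f a ∂μ
  map_add' f g := by
    ext i
    simp only [PiLp.add_apply]
    rw [← mul_add, ← integral_add (integrable_of_Lp f).restrict (integrable_of_Lp g).restrict]
    congr 1
    exact integral_congr_ae (ae_restrict_of_ae (Lp.coeFn_add f g))
  map_smul' c f := by
    ext i
    simp only [PiLp.smul_apply, RingHom.id_apply, smul_eq_mul]
    rw [mul_left_comm, ← integral_const_mul c]
    congr 1
    exact integral_congr_ae (ae_restrict_of_ae (Lp.coeFn_smul c f))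

theorem lpAverage_apply {ι : Type*} (A : ι → Set α) (f : Lp 𝕜 p μ) (i : ι) :
    lpAverage p μ A f i =
      ((μ.real (A i) ^ (p.toReal⁻¹ - 1) : ℝ) : 𝕜) * ∫ a in A i, f a ∂μ := rfl

/-- Hölder on `A i` costs a factor `μ(A i) ^ (1 - 1 / p)`, which the normalization cancels. -/
theorem norm_lpAverage_apply_rpow_le (hp : p ≠ ∞) {ι : Type*} (A : ι → Set α) (f : Lp 𝕜 p μ)
    (i : ι) : ‖lpAverage p μ A f i‖ ^ p.toReal ≤ ∫ a in A i, ‖f a‖ ^ p.toReal ∂μ := by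
  have hr := ENNReal.one_le_toReal_of_fact hp
  have hmem : MemLp f p (μ.restrict (A i)) := (Lp.memLp f).restrict (A i)
  rw [← toReal_eLpNorm_rpow_eq_integral hp hmem, lpAverage_apply]
  refine Real.rpow_le_rpow (norm_nonneg _) ?_ (by positivity)
  have hm : 0 ≤ μ.real (A i) := measureReal_nonneg
  rw [norm_mul, RCLike.norm_ofReal, abs_of_nonneg (Real.rpow_nonneg hm _)]
  have h1 : ‖∫ a in A i, f a ∂μ‖ ≤
      (eLpNorm f p (μ.restrict (A i))).toReal * μ.real (A i) ^ (1 - p.toReal⁻¹) := by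
    have h := eLpNorm_le_eLpNorm_mul_rpow_measure_univ (Fact.out : 1 ≤ p) hmem.1
    have h' := (enorm_integral_le_lintegral_enorm (μ := μ.restrict (A i)) f).trans
      (eLpNorm_one_eq_lintegral_enorm.symm.le.trans h)
    have hfin : μ (A i) ^ (1 - p.toReal⁻¹) ≠ ∞ :=
      ENNReal.rpow_ne_top_of_nonneg (sub_nonneg.2 (inv_le_one_of_one_le₀ hr)) (measure_ne_top _ _)
    simp only [ENNReal.toReal_one, Measure.restrict_apply_univ, one_div, inv_one] at h'
    have h'' := ENNReal.toReal_mono (ENNReal.mul_ne_top hmem.2.ne hfin) h'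
    rwa [toReal_enorm, ENNReal.toReal_mul, ← ENNReal.toReal_rpow] at h''
  rcases hm.eq_or_lt with h0 | h0
  · have h2 : ∫ a in A i, f a ∂μ = 0 := by
      rw [Measure.restrict_eq_zero.2 ((measureReal_eq_zero_iff).1 h0.symm), integral_zero_measure]
    simp [h2]
  · calc _ ≤ μ.real (A i) ^ (p.toReal⁻¹ - 1) *
        ((eLpNorm f p (μ.restrict (A i))).toReal * μ.real (A i) ^ (1 - p.toReal⁻¹)) := by gcongr
      _ = (eLpNorm f p (μ.restrict (A i))).toReal *
          (μ.real (A i) ^ (p.toReal⁻¹ - 1) * μ.real (A i) ^ (1 - p.toReal⁻¹)) := by ring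
      _ = _ := by rw [← Real.rpow_add h0]; simp

variable {ι : Type*} [Fintype ι] {A : ι → Set α}

theorem sum_setIntegral_norm_rpow (hp : p ≠ ∞) (hA : ∀ i, MeasurableSet (A i))
    (hd : Pairwise (Function.onFun Disjoint A)) (hU : ⋃ i, A i = Set.univ) (f : Lp 𝕜 p μ) :
    ∑ i, ∫ a in A i, ‖f a‖ ^ p.toReal ∂μ = ‖f‖ ^ p.toReal := by
  rw [Lp.norm_rpow_eq_integral hp, ← setIntegral_univ (μ := μ), ← hU]
  exact (integral_iUnion_fintype hA hd fun i =>
    ((Lp.memLp f).integrable_norm_rpow' ).integrableOn).symm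

theorem norm_lpAverage_le (hp : p ≠ ∞) (hA : ∀ i, MeasurableSet (A i))
    (hd : Pairwise (Function.onFun Disjoint A)) (hU : ⋃ i, A i = Set.univ) (f : Lp 𝕜 p μ) :
    ‖lpAverage p μ A f‖ ≤ ‖f‖ := by
  have hr := ENNReal.one_le_toReal_of_fact hp
  rw [← Real.rpow_le_rpow_iff (norm_nonneg _) (norm_nonneg _) (zero_lt_one.trans_le hr),
    PiLp.norm_rpow_eq_sum hp, ← sum_setIntegral_norm_rpow hp hA hd hU]
  exact Finset.sum_le_sum fun i _ => norm_lpAverage_apply_rpow_le hp A f i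

/-- Averaging preserves the norm of a function that is constant on each set of the partition. -/
theorem norm_lpAverage_eq (hp : p ≠ ∞) (hA : ∀ i, MeasurableSet (A i))
    (hd : Pairwise (Function.onFun Disjoint A)) (hU : ⋃ i, A i = Set.univ) (f : Lp 𝕜 p μ)
    (c : ι → 𝕜) (hc : ∀ i, ∀ᵐ a ∂μ.restrict (A i), f a = c i) :
    ‖lpAverage p μ A f‖ = ‖f‖ := by
  have hr := ENNReal.one_le_toReal_of_fact hp
  have hr0 : p.toReal ≠ 0 := by positivity
  rw [← Real.rpow_left_inj (norm_nonneg _) (norm_nonneg _) hr0,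
    PiLp.norm_rpow_eq_sum hp, ← sum_setIntegral_norm_rpow hp hA hd hU]
  refine Finset.sum_congr rfl fun i _ => ?_
  have hm : 0 ≤ μ.real (A i) := measureReal_nonneg
  have h1 : ∫ a in A i, f a ∂μ = (μ.real (A i) : 𝕜) * c i := by
    rw [integral_congr_ae (hc i), setIntegral_const, RCLike.real_smul_eq_coe_mul]
  have h2 : ∫ a in A i, ‖f a‖ ^ p.toReal ∂μ = μ.real (A i) * ‖c i‖ ^ p.toReal := by
    rw [integral_congr_ae ((hc i).mono fun a ha => by simp only [ha] :
      (fun a => ‖f a‖ ^ p.toReal) =ᵐ[μ.restrict (A i)] fun _ => ‖c i‖ ^ p.toReal),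
      setIntegral_const, smul_eq_mul]
  rw [lpAverage_apply, h1, h2, ← mul_assoc, ← RCLike.ofReal_mul, norm_mul,
    Real.mul_rpow (norm_nonneg _) (norm_nonneg _), RCLike.norm_ofReal,
    abs_of_nonneg (mul_nonneg (Real.rpow_nonneg hm _) hm)]
  congr 1
  rcases hm.eq_or_lt with h0 | h0
  · simp [← h0, Real.zero_rpow hr0]
  · rw [← Real.rpow_add_one h0.ne', sub_add_cancel, Real.rpow_inv_rpow hm hr0]

/-- Finitely many elements of `L_p` are almost normed by a contraction into a finite-dimensional
`ℓ_p`. -/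
theorem exists_almost_norming_contraction (hp : p ≠ ∞) {κ : Type} [Finite κ]
    (f : κ → Lp 𝕜 p μ) :
    ∃ (ι : Type w) (_ : Fintype ι) (u : Lp 𝕜 p μ →ₗ[𝕜] PiLp p (fun _ : ι => 𝕜)),
      (∀ g, ‖u g‖ ≤ ‖g‖) ∧ ∀ j, ‖f j‖ ≤ 2 * ‖u (f j)‖ := by
  classical
  cases nonempty_fintype κ
  -- With error `‖f j‖ / 4` and `u` a contraction preserving the norm of the approximant, `‖u (f j)‖
  -- ≥ ‖f j‖ - 2 * (‖f j‖ / 4)`: hence the factor `2`.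
  have happ : ∀ j, ∃ (s : SimpleFunc α 𝕜) (hs : MemLp s p μ), ‖f j - hs.toLp s‖ ≤ ‖f j‖ / 4 := by
    intro j
    rcases eq_or_ne (f j) 0 with h0 | h0
    · refine ⟨0, MemLp.zero, ?_⟩
      have : (MemLp.zero : MemLp (⇑(0 : SimpleFunc α 𝕜)) p μ).toLp _ = 0 := MemLp.toLp_zero _
      simp [h0, this]
    · obtain ⟨s, hs, hsm⟩ := (Lp.memLp (f j)).exists_simpleFunc_eLpNorm_sub_lt hp
        (ε := ENNReal.ofReal (‖f j‖ / 4)) (by simpa using h0)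
      refine ⟨s, hsm, ?_⟩
      have h1 : f j - hsm.toLp s = ((Lp.memLp (f j)).sub hsm).toLp _ := by
        rw [MemLp.toLp_sub (Lp.memLp (f j)) hsm, Lp.toLp_coeFn]
      rw [h1, Lp.norm_toLp]
      exact ENNReal.toReal_le_of_le_ofReal (by positivity) hs.le
  choose s hs happ using happ
  -- Cells are indexed by the joint values of all the simple functions, so each of these is constant
  -- on every cell; empty cells are harmless.
  let ι := {c : κ → 𝕜 // c ∈ Fintype.piFinset fun j => (s j).range}
  let A : ι → Set α := fun c => ⋂ j, s j ⁻¹' {c.1 j}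
  have hA : ∀ c, MeasurableSet (A c) := fun c =>
    MeasurableSet.iInter fun j => (s j).measurableSet_fiber _
  have hmemA : ∀ c a, a ∈ A c ↔ ∀ j, s j a = c.1 j := fun c a => by simp [A]
  have hd : Pairwise (Function.onFun Disjoint A) := fun c d hcd =>
    Set.disjoint_left.2 fun a hac had => hcd (Subtype.ext (funext fun j =>
      ((hmemA c a).1 hac j).symm.trans ((hmemA d a).1 had j)))
  have hU : ⋃ c, A c = Set.univ := Set.eq_univ_of_forall fun a =>
    Set.mem_iUnion.2 ⟨⟨fun j => s j a, by simp⟩, (hmemA _ a).2 fun j => rfl⟩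
  refine ⟨ι, inferInstance, lpAverage p μ A, norm_lpAverage_le hp hA hd hU, fun j => ?_⟩
  have h1 : ‖lpAverage p μ A ((hs j).toLp (s j))‖ = ‖(hs j).toLp (s j)‖ :=
    norm_lpAverage_eq hp hA hd hU _ (fun c => c.1 j) fun c => by
      filter_upwards [ae_restrict_of_ae (hs j).coeFn_toLp, ae_restrict_mem (hA c)] with a ha haA
      rw [ha, (hmemA c a).1 haA j]
  have h2 := norm_lpAverage_le hp hA hd hU (f j - (hs j).toLp (s j))
  rw [map_sub] at h2
  have h3 := norm_sub_norm_le (f j) ((hs j).toLp (s j))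
  have h4 := norm_sub_norm_le (lpAverage p μ A ((hs j).toLp (s j))) (lpAverage p μ A (f j))
  rw [norm_sub_rev] at h4
  linarith [happ j]

/-- In a space embedding isometrically into some `L_p(μ)`, mid `p`-summable sequences are
absolutely `p`-summable. -/
theorem MidSummableSeq.memℓp_of_linearIsometry (hp : p ≠ ∞) {X : Type*} [NormedAddCommGroup X]
    [NormedSpace 𝕜 X] (J : X →ₗᵢ[𝕜] Lp 𝕜 p μ) {x : ℕ → X} (hx : MidSummableSeq 𝕜 p x) :
    Memℓp x p := by
  have hr := ENNReal.one_le_toReal_of_fact hp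
  obtain ⟨C, hC⟩ := hx.exists_sum_bound hp
  rw [memℓp_iff_summable_norm_rpow hp]
  -- `C` depends on neither `s` nor the contraction chosen for it; `2 ^ p` comes from the almost
  -- norming factor.
  refine summable_of_sum_le (c := 2 ^ p.toReal * C) (fun n => by positivity) fun s => ?_
  obtain ⟨ι, _, u, hu, hus⟩ := exists_almost_norming_contraction hp fun j : s => J (x j)
  let U : X →L[𝕜] PiLp p (fun _ : ι => 𝕜) :=
    (u ∘ₗ J.toLinearMap).mkContinuous 1 fun y => by
      rw [one_mul, ← J.norm_map y]
      exact hu (J y)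
  have hU : ∀ y, ∑ i, ‖(PiLp.proj p (fun _ : ι => 𝕜) i ∘L U) y‖ ^ p.toReal =
    ‖u (J y)‖ ^ p.toReal := fun y => (PiLp.norm_rpow_eq_sum hp (u (J y))).symm
  have h := hC ι (fun i => PiLp.proj p (fun _ : ι => 𝕜) i ∘L U) (fun y hy => by
    rw [hU]
    exact Real.rpow_le_one (norm_nonneg _) ((hu _).trans (by rwa [J.norm_map])) (by positivity)) s
  simp only [hU] at h
  refine le_trans ?_ (mul_le_mul_of_nonneg_left h (by positivity))
  rw [Finset.mul_sum]
  refine Finset.sum_le_sum fun j hj => ?_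
  rw [← Real.mul_rpow zero_le_two (norm_nonneg _)]
  refine Real.rpow_le_rpow (norm_nonneg _) ?_ (by positivity)
  simpa using hus ⟨j, hj⟩

end LpAverages

/-! ### Factorization through the completion for the `L_p(μ)` seminorm. -/

/-- The completion of a vector space for the seminorm pulled back along a linear map; it lives in
the universe of the vector space. -/
theorem exists_completion_of_linearMap {𝕜 : Type*} [NormedField 𝕜] {E : Type u} [AddCommGroup E]
    [Module 𝕜 E] {L : Type*} [NormedAddCommGroup L] [NormedSpace 𝕜 L] (J : E →ₗ[𝕜] L) :
    ∃ (X : Type u) (_ : NormedAddCommGroup X) (_ : NormedSpace 𝕜 X) (_ : CompleteSpace X)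
      (e : E →ₗ[𝕜] X), DenseRange e ∧ ∀ x, ‖e x‖ = ‖J x‖ := by
  let _ : SeminormedAddCommGroup E := SeminormedAddCommGroup.induced E L J
  let _ : NormedSpace 𝕜 E := NormedSpace.induced 𝕜 E L J
  -- The completion is Hausdorff, so the kernel of `J` is collapsed.
  exact ⟨UniformSpace.Completion E, inferInstance, inferInstance, inferInstance,
    (UniformSpace.Completion.toComplL (𝕜 := 𝕜) (E := E)).toLinearMap,
    UniformSpace.Completion.denseRange_coe, fun x => UniformSpace.Completion.norm_coe x⟩

section Factorization

variable {𝕜 : Type w} [RCLike 𝕜] {p : ℝ≥0∞} [Fact (1 ≤ p)]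
  {E : Type u} {F : Type v} [NormedAddCommGroup E] [NormedSpace 𝕜 E]
  [NormedAddCommGroup F] [NormedSpace 𝕜 F]

theorem DualUnitBall.norm_eval_le (x : E) : ‖DualUnitBall.eval 𝕜 E x‖ ≤ ‖x‖ :=
  (ContinuousMap.norm_le _ (norm_nonneg x)).2 fun k =>
    ((WeakDual.toStrongDual k.1).le_of_opNorm_le k.norm_le x).trans_eq (one_mul _)

theorem norm_toLp_eval_rpow (hp : p ≠ ∞) (μ : Measure (DualUnitBall 𝕜 E)) [IsFiniteMeasure μ]
    (x : E) : ‖ContinuousMap.toLp p μ 𝕜 (DualUnitBall.eval 𝕜 E x)‖ ^ p.toReal =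
      ∫ k, ‖DualUnitBall.eval 𝕜 E x k‖ ^ p.toReal ∂μ := by
  rw [Lp.norm_rpow_eq_integral hp]
  refine integral_congr_ae ?_
  filter_upwards [ContinuousMap.coeFn_toLp (p := p) (𝕜 := 𝕜) μ (DualUnitBall.eval 𝕜 E x)] with k hk
  rw [hk]

/-- Evaluation into `L_p` of a finite measure on the dual unit ball is absolutely summing. -/
theorem memℓp_toLp_eval (hp : p ≠ ∞) (μ : Measure (DualUnitBall 𝕜 E)) [IsFiniteMeasure μ]
    {x : ℕ → E} (hx : WeaklySummableSeq 𝕜 p x) :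
    Memℓp (fun j => ContinuousMap.toLp p μ 𝕜 (DualUnitBall.eval 𝕜 E (x j))) p := by
  have hr := ENNReal.one_le_toReal_of_fact hp
  obtain ⟨C, hC0, hC⟩ := hx.exists_sum_bound hp
  rw [memℓp_iff_summable_norm_rpow hp]
  refine summable_of_sum_le (c := μ.real Set.univ * C) (fun n => by positivity) fun s => ?_
  simp only [norm_toLp_eval_rpow hp]
  have hcont : ∀ j, Continuous fun k => ‖DualUnitBall.eval 𝕜 E (x j) k‖ ^ p.toReal := fun j =>
    (DualUnitBall.eval 𝕜 E (x j)).continuous.norm.rpow_const fun _ => Or.inr (by positivity)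
  have hi : ∀ j, Integrable (fun k => ‖DualUnitBall.eval 𝕜 E (x j) k‖ ^ p.toReal) μ := fun j =>
    (hcont j).integrable_of_hasCompactSupport (HasCompactSupport.of_compactSpace _)
  rw [← integral_finsetSum s fun j _ => hi j, ← smul_eq_mul, ← integral_const]
  -- The weak bound holds at every point of the dual ball with the same `C`, and is integrated
  -- against `μ`.
  refine integral_mono (integrable_finsetSum s fun j _ => hi j) (integrable_const C) fun k => ?_
  refine (hC (WeakDual.toStrongDual k.1) s).trans (mul_le_of_le_one_right hC0 ?_)
  exact Real.rpow_le_one (norm_nonneg _) k.norm_le (by positivity)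

/-- Absolutely `p`-summing operators factor through a subspace of some `L_p(μ)`. -/
theorem exists_factorization_of_absolutelySumming [CompleteSpace F] (hp : p ≠ ∞) {T : E →L[𝕜] F}
    (hT : T ∈ absolutelySumming 𝕜 p E F) :
    ∃ (X : Type u) (_ : NormedAddCommGroup X) (_ : NormedSpace 𝕜 X)
      (_ : CompleteSpace X), ∃ w ∈ weaklyMidSumming 𝕜 p E X,
        ∃ v ∈ absolutelyMidSumming 𝕜 p X F, T = v ∘L w := by
  have hr := ENNReal.one_le_toReal_of_fact hp
  have hr0 : p.toReal ≠ 0 := by positivity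
  obtain ⟨C, hC0, hC⟩ := exists_summing_constant hp (T : E →ₗ[𝕜] F) hT
  obtain ⟨μ, _, hμ⟩ := exists_pietsch_measure hr (T : E →ₗ[𝕜] F) hC
  let J : E →ₗ[𝕜] Lp 𝕜 p μ :=
    (ContinuousMap.toLp p μ 𝕜).toLinearMap ∘ₗ DualUnitBall.eval 𝕜 E
  obtain ⟨X, _, _, _, e, he, hnorm⟩ := exists_completion_of_linearMap J
  have hw : ∃ c, ∀ x, ‖e x‖ ≤ c * ‖x‖ := by
    let A : C(DualUnitBall 𝕜 E, 𝕜) →L[𝕜] Lp 𝕜 p μ := ContinuousMap.toLp p μ 𝕜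
    refine ⟨‖A‖, fun x => ?_⟩
    rw [hnorm]
    exact (A.le_opNorm _).trans
      (mul_le_mul_of_nonneg_left (DualUnitBall.norm_eval_le x) (norm_nonneg A))
  -- Pietsch domination says that `T` is bounded by `C ^ (1 / p)` for the norm of `X`, so it extends
  -- from the dense range of `e`.
  have hTe : ∃ c, ∀ x, ‖(T : E →ₗ[𝕜] F) x‖ ≤ c * ‖e x‖ := by
    refine ⟨C ^ (p.toReal)⁻¹, fun x => ?_⟩
    rw [← Real.rpow_le_rpow_iff (norm_nonneg _) (by positivity) (zero_lt_one.trans_le hr),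
      Real.mul_rpow (by positivity) (norm_nonneg _), Real.rpow_inv_rpow hC0 hr0, hnorm]
    exact (hμ x).trans_eq (congrArg (C * ·) (norm_toLp_eval_rpow hp μ x).symm)
  have hJe : ∃ c, ∀ x, ‖J x‖ ≤ c * ‖e x‖ := ⟨1, fun x => by rw [one_mul, hnorm]⟩
  let I : X →ₗᵢ[𝕜] Lp 𝕜 p μ :=
    { (J.extendOfNorm e).toLinearMap with
      norm_map' := fun y => by
        change ‖J.extendOfNorm e y‖ = ‖y‖
        refine he.induction_on (p := fun y => ‖J.extendOfNorm e y‖ = ‖y‖) y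
          (isClosed_eq (J.extendOfNorm e).continuous.norm continuous_norm) fun x => ?_
        rw [LinearMap.extendOfNorm_eq he hJe, hnorm] }
  refine ⟨X, inferInstance, inferInstance, inferInstance,
    e.mkContinuousOfExistsBound hw, fun x hx => ?_,
    (T : E →ₗ[𝕜] F).extendOfNorm e, fun x hx => ?_, ?_⟩
  · refine midSummableSeq_of_memℓp hp ?_
    have h := memℓp_toLp_eval hp μ hx
    rw [memℓp_iff_summable_norm_rpow hp] at h ⊢
    refine h.congr fun j => congrArg (· ^ p.toReal) ?_
    exact (hnorm (x j)).symm
  · have h := hx.memℓp_of_linearIsometry hp I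
    rw [memℓp_iff_summable_norm_rpow hp] at h ⊢
    set V := (T : E →ₗ[𝕜] F).extendOfNorm e
    refine Summable.of_nonneg_of_le (fun j => by positivity) (fun j => ?_)
      (h.mul_left (‖V‖ ^ p.toReal))
    rw [← Real.mul_rpow (norm_nonneg _) (norm_nonneg _)]
    exact Real.rpow_le_rpow (norm_nonneg _) (V.le_opNorm _) (by positivity)
  · ext x
    exact (LinearMap.extendOfNorm_eq he hTe x).symm

end Factorization

theorem theorem2p8 {𝕜 : Type*} [RCLike 𝕜] (p : ℝ≥0∞) [Fact (1 ≤ p)] (hp : p ≠ ∞)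
    (E : Type u) [NormedAddCommGroup E] [NormedSpace 𝕜 E] [CompleteSpace E]
    (F : Type v) [NormedAddCommGroup F] [NormedSpace 𝕜 F] [CompleteSpace F] :
    absolutelySumming 𝕜 p E F =
      {T : E →L[𝕜] F | ∃ (X : Type u) (_ : NormedAddCommGroup X) (_ : NormedSpace 𝕜 X)
        (_ : CompleteSpace X), ∃ w ∈ weaklyMidSumming 𝕜 p E X,
          ∃ v ∈ absolutelyMidSumming 𝕜 p X F, T = v ∘L w} := by
  refine Set.Subset.antisymm (fun T hT => exists_factorization_of_absolutelySumming hp hT) ?_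
  rintro T ⟨X, _, _, _, w, hw, v, hv, rfl⟩
  exact fun x hx => hv _ (hw x hx)
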